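/- Let $K\ge 1$ agents and a finite set $\Theta$ of hypotheses be given, with a true hypothesis $\theta^\circ\in\Theta$. For each agent $k$ and each $\theta\in\Theta$ let $L_k(\cdot|\theta)$ be a probability density on the signal space of agent $k$, with respect to a reference measure that does not depend on $\theta$. At each time $j=1,2,\dots$ the agents observe signals $\boldsymbol\xi_j=(\boldsymbol\xi_{1,j},\dots,\boldsymbol\xi_{K,j})$; the vectors $\boldsymbol\xi_j$ are i.i.d. over $j$ (with arbitrary dependence between the agents), and $\boldsymbol\xi_{k,j}$ has density $L_k(\cdot|\theta^\circ)$. Assume that $D(L_k(\cdot|\theta^\circ)\,\|\,L_k(\cdot|\theta))<\infty$ for all $k$ and all $\theta\in\Theta$. Let $A=[a_{\ell k}]$ be a primitive $K\times K$ matrix (its entries are nonnegative, and some power $A^n$, $n\ge1$, has only positive entries) that is left-stochastic ($\sum_{\ell}a_{\ell k}=1$ for each $k$). Fix a hypothesis $\theta\in\Theta$, let $\boldsymbol R_j$ be the diagonal matrix with $k$-th diagonal entry $\boldsymbol r_{k,j}=L_k(\boldsymbol\xi_{k,j}|\theta)/L_k(\boldsymbol\xi_{k,j}|\theta^\circ)$,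 and let $$\boldsymbol Y_i=\prod_{j=1}^i (A^{\mathsf T}\boldsymbol R_j)=(A^{\mathsf T}\boldsymbol R_1)(A^{\mathsf T}\boldsymbol R_2)\cdots(A^{\mathsf T}\boldsymbol R_i).$$ Then there is a constant (deterministic, finite) $\gamma\in\mathbb R$, depending on neither $\ell$ nor $k$, such that for all $\ell,k\in\{1,\dots,K\}$: for all sufficiently large $i$, $[\boldsymbol Y_i]_{\ell k}>0$ almost surely and $\log[\boldsymbol Y_i]_{\ell k}$ is integrable; and $$\lim_{i\to\infty}\frac1i\log[\boldsymbol Y_i]_{\ell k}=\gamma\ \text{ almost surely},\qquad \lim_{i\to\infty}\frac1i\,\mathbb E\big[\log[\boldsymbol Y_i]_{\ell k}\big]=\gamma .$$ -/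

import Mathlib

open MeasureTheory ProbabilityTheory Filter Topology InformationTheory
open scoped ENNReal

/-- The likelihoods of a family of agents: agent `k` observes signals in `𝒳 k` and has, for every
hypothesis `θ`, a probability density `L k θ`, that is `L_k(· | θ)`, with respect to a reference
measure `ref k` (a counting measure for discrete signals, Lebesgue measure for continuous ones).
The reference measure depends on the agent but not on the hypothesis. -/
structure LikelihoodModel (ι Θ : Type*) (𝒳 : ι → Type*) [∀ k, MeasurableSpace (𝒳 k)] where
  /-- reference measure on the signal space of agent `k` -/
  ref : ∀ k, Measure (𝒳 k)
  /-- the likelihood `L_k(x | θ)` -/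
  L : ∀ k, Θ → 𝒳 k → ℝ
  measurable_L : ∀ k θ, Measurable (L k θ)
  nonneg_L : ∀ k θ x, 0 ≤ L k θ x
  lintegral_L : ∀ k θ, ∫⁻ x, ENNReal.ofReal (L k θ x) ∂(ref k) = 1

namespace LikelihoodModel

variable {ι Θ : Type*} {𝒳 : ι → Type*} [∀ k, MeasurableSpace (𝒳 k)]

/-- The distribution on the signal space of agent `k` with density `L_k(· | θ)`. -/
noncomputable def law (M : LikelihoodModel ι Θ 𝒳) (k : ι) (θ : Θ) : Measure (𝒳 k) :=
  (M.ref k).withDensity (fun x => ENNReal.ofReal (M.L k θ x))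

/-- Finite KL divergences: `D(L_k(· | θ₀) ‖ L_k(· | θ)) < ∞` for all agents `k` and all
hypotheses `θ`. -/
def FiniteKL (M : LikelihoodModel ι Θ 𝒳) (θ₀ : Θ) : Prop :=
  ∀ k θ, klDiv (M.law k θ₀) (M.law k θ) < ∞

/-- `ξ j ω k` is the signal of agent `k` at time `j + 1`. The signal profiles are i.i.d. over
time, and the signal of agent `k` has the density `L_k(· | θ₀)`. Nothing is assumed about the
dependence between the signals of different agents at one time. -/
structure IsObservation (M : LikelihoodModel ι Θ 𝒳) (θ₀ : Θ) {Ω : Type*} [MeasurableSpace Ω]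
    (P : Measure Ω) (ξ : ℕ → Ω → ∀ k, 𝒳 k) : Prop where
  measurable : ∀ j, Measurable (ξ j)
  indep : iIndepFun ξ P
  identDistrib : ∀ j, IdentDistrib (ξ j) (ξ 0) P P
  map_eq : ∀ j k, P.map (fun ω => ξ j ω k) = M.law k θ₀

/-- The likelihood ratio `r_k = L_k(x_k | θ) / L_k(x_k | θ₀)` at the signal profile `x`. -/
noncomputable def ratio (M : LikelihoodModel ι Θ 𝒳) (θ₀ θ : Θ) (x : ∀ k, 𝒳 k) (k : ι) : ℝ :=
  M.L k θ (x k) / M.L k θ₀ (x k)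

/-- The random matrix product `Y_i = (Aᵀ R_1) (Aᵀ R_2) ⋯ (Aᵀ R_i)`, in this order, where `R_j` is
the diagonal matrix of the likelihood ratios of the signals `ξ (j - 1)` observed at time `j`. -/
noncomputable def matrixProduct [Fintype ι] [DecidableEq ι] (M : LikelihoodModel ι Θ 𝒳)
    (A : Matrix ι ι ℝ) (θ₀ θ : Θ) {Ω : Type*} (ξ : ℕ → Ω → ∀ k, 𝒳 k) (i : ℕ) (ω : Ω) :
    Matrix ι ι ℝ :=
  ((List.range i).map
    (fun j => A.transpose * Matrix.diagonal (M.ratio θ₀ θ (ξ j ω)))).prod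

end LikelihoodModel

/-! This is the Furstenberg–Kesten theorem for positive factors, and independence makes it
elementary. The sum of the entries of a nonnegative matrix is submultiplicative, so the expected
logarithm of the entry sum of `Y_n` is subadditive by stationarity, and Fekete's lemma yields the
rate `γ`. It is finite because finite KL divergence makes the log-likelihood ratios integrable
(`integrable_log_ratio_law`) and `matProd_bounds` compares `Y_n` with a power of `Aᵀ`.

The smallest entry is supermultiplicative. By primitivity, enclosing a block of length `m` between
two blocks of fixed length `N` with positive entries turns its entry sum into a lower bound for the
smallest entry of the whole (`entryMin_mul_mul_le`), at a cost independent of `m` in expectation.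
Hence the smallest entry has the same mean rate `γ`, and every entry is squeezed in between.

For almost sure convergence, `M` is chosen such that the mean logarithms of both quantities at
length `M`, divided by `M`, are within `ε` of `γ`. Cutting a long product into blocks of length `M`
bounds its logarithm from both sides by sums of i.i.d. terms, to which the strong law applies
(`strong_law_blocks`). -/

section MatrixProducts

variable {ι : Type*} [Fintype ι]

/-! ### Entry sums and smallest entries of nonnegative matrices -/

/-- The sum of the entries of a square matrix. -/
def entrySum (X : Matrix ι ι ℝ) : ℝ := ∑ l, ∑ k, X l k

/-- The smallest entry of a square matrix. -/
noncomputable def entryMin [Nonempty ι] (X : Matrix ι ι ℝ) : ℝ :=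
  Finset.univ.inf' Finset.univ_nonempty (fun p : ι × ι => X p.1 p.2)

lemma entryMin_le [Nonempty ι] (X : Matrix ι ι ℝ) (l k : ι) : entryMin X ≤ X l k :=
  Finset.inf'_le (fun p : ι × ι => X p.1 p.2) (Finset.mem_univ (l, k))

lemma le_entryMin [Nonempty ι] {X : Matrix ι ι ℝ} {c : ℝ} (h : ∀ l k, c ≤ X l k) :
    c ≤ entryMin X :=
  Finset.le_inf' _ _ fun p _ => h p.1 p.2

lemma entryMin_pos [Nonempty ι] {X : Matrix ι ι ℝ} (h : ∀ l k, 0 < X l k) : 0 < entryMin X := by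
  rw [entryMin, Finset.lt_inf'_iff]
  exact fun p _ => h p.1 p.2

lemma le_entrySum {X : Matrix ι ι ℝ} (h : ∀ l k, 0 ≤ X l k) (l k : ι) : X l k ≤ entrySum X :=
  (Finset.single_le_sum (f := fun k => X l k) (fun k _ => h l k) (Finset.mem_univ k)).trans
    (Finset.single_le_sum (f := fun l => ∑ k, X l k)
      (fun l _ => Finset.sum_nonneg fun k _ => h l k) (Finset.mem_univ l))

lemma entryMin_le_entrySum [Nonempty ι] {X : Matrix ι ι ℝ} (h : ∀ l k, 0 ≤ X l k) :
    entryMin X ≤ entrySum X :=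
  (entryMin_le X (Classical.arbitrary ι) (Classical.arbitrary ι)).trans (le_entrySum h _ _)

lemma log_entry_bounds [Nonempty ι] {X : Matrix ι ι ℝ} (hX : 0 < entryMin X) (l k : ι) :
    Real.log (entryMin X) ≤ Real.log (X l k) ∧ Real.log (X l k) ≤ Real.log (entrySum X) := by
  have hnn : ∀ l k, 0 ≤ X l k := fun l k => hX.le.trans (entryMin_le X l k)
  exact ⟨Real.log_le_log hX (entryMin_le X l k),
    Real.log_le_log (hX.trans_le (entryMin_le X l k)) (le_entrySum hnn l k)⟩

lemma entrySum_mul_le {X Y : Matrix ι ι ℝ} (hX : ∀ l k, 0 ≤ X l k) (hY : ∀ l k, 0 ≤ Y l k) :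
    entrySum (X * Y) ≤ entrySum X * entrySum Y := by
  have h (l : ι) : ∑ k, (X * Y) l k ≤ (∑ p, X l p) * entrySum Y := by
    simp only [Matrix.mul_apply]
    rw [Finset.sum_comm, Finset.sum_mul]
    refine Finset.sum_le_sum fun p _ => ?_
    rw [← Finset.mul_sum]
    exact mul_le_mul_of_nonneg_left (Finset.single_le_sum (f := fun l => ∑ k, Y l k)
      (fun l _ => Finset.sum_nonneg fun k _ => hY l k) (Finset.mem_univ p)) (hX l p)
  calc entrySum (X * Y) ≤ ∑ l, (∑ p, X l p) * entrySum Y := Finset.sum_le_sum fun l _ => h l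
    _ = entrySum X * entrySum Y := (Finset.sum_mul _ _ _).symm

/-- In `∑ p q, X l p * Y p q * Z q k` the outer factors are bounded below by constants, which leaves
the full sum of the entries of `Y`, even if `Y` has zeros. -/
lemma entryMin_mul_mul_le [Nonempty ι] {X Y Z : Matrix ι ι ℝ} (hX : 0 ≤ entryMin X)
    (hY : ∀ l k, 0 ≤ Y l k) (hZ : 0 ≤ entryMin Z) :
    entryMin X * entrySum Y * entryMin Z ≤ entryMin (X * Y * Z) := by
  refine le_entryMin fun l k => ?_
  have h (q : ι) : entryMin X * ∑ p, Y p q ≤ (X * Y) l q := by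
    rw [Matrix.mul_apply, Finset.mul_sum]
    exact Finset.sum_le_sum fun p _ => mul_le_mul_of_nonneg_right (entryMin_le X l p) (hY p q)
  have hsum : entrySum Y = ∑ q, ∑ p, Y p q := Finset.sum_comm
  rw [Matrix.mul_apply, hsum, Finset.mul_sum, Finset.sum_mul]
  refine Finset.sum_le_sum fun q _ => mul_le_mul (h q) (entryMin_le Z q k) hZ ?_
  exact (mul_nonneg hX (Finset.sum_nonneg fun p _ => hY p q)).trans (h q)

lemma entryMin_mul_le [Nonempty ι] {X Y : Matrix ι ι ℝ} (hX : 0 ≤ entryMin X)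
    (hY : 0 ≤ entryMin Y) : entryMin X * entryMin Y ≤ entryMin (X * Y) := by
  refine le_entryMin fun l k => ?_
  rw [Matrix.mul_apply]
  have hp : ∀ p, entryMin X * entryMin Y ≤ X l p * Y p k := fun p =>
    mul_le_mul (entryMin_le X l p) (entryMin_le Y p k) hY (hX.trans (entryMin_le X l p))
  exact (hp (Classical.arbitrary ι)).trans (Finset.single_le_sum (f := fun p => X l p * Y p k)
    (fun p _ => (mul_nonneg hX hY).trans (hp p)) (Finset.mem_univ _))

variable [DecidableEq ι]

/-! ### Deterministic bounds for the products -/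

/-- The product `(Aᵀ diag(r₀)) ⋯ (Aᵀ diag(rₙ₋₁))`. -/
noncomputable def matProd (A : Matrix ι ι ℝ) (r : ℕ → ι → ℝ) (n : ℕ) : Matrix ι ι ℝ :=
  ((List.range n).map (fun j => A.transpose * Matrix.diagonal (r j))).prod

lemma matProd_add (A : Matrix ι ι ℝ) (r : ℕ → ι → ℝ) (m n : ℕ) :
    matProd A r (m + n) = matProd A r m * matProd A (fun j => r (m + j)) n := by
  simp [matProd, List.range_add, List.map_map, Function.comp_def]

lemma matProd_succ_apply (A : Matrix ι ι ℝ) (r : ℕ → ι → ℝ) (n : ℕ) (l k : ι) :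
    matProd A r (n + 1) l k = (∑ p, matProd A r n l p * A k p) * r n k := by
  simp only [matProd, List.range_succ, List.map_append, List.prod_append, List.map_cons,
    List.map_nil, List.prod_singleton, ← Matrix.mul_assoc, Matrix.mul_diagonal]
  simp [Matrix.mul_apply]

lemma matProd_congr (A : Matrix ι ι ℝ) {r s : ℕ → ι → ℝ} {n : ℕ} (h : ∀ j < n, r j = s j) :
    matProd A r n = matProd A s n := by
  unfold matProd
  congr 1
  exact List.map_congr_left fun j hj => by rw [h j (List.mem_range.1 hj)]

lemma measurable_matProd (A : Matrix ι ι ℝ) (n : ℕ) (l k : ι) :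
    Measurable fun r : ℕ → ι → ℝ => matProd A r n l k := by
  induction n generalizing l k with
  | zero => simp [matProd]
  | succ n ih =>
    simp only [matProd_succ_apply]
    fun_prop

/-- The total size `∑_{j < n} ∑ₖ |log rⱼₖ|` of the logarithms. -/
noncomputable def logSize (r : ℕ → ι → ℝ) (n : ℕ) : ℝ :=
  ∑ j ∈ Finset.range n, ∑ k, |Real.log (r j k)|

/-- Each diagonal factor lies between the scalars `exp (∓∑ₖ |log rⱼₖ|)`. Pulling these out leaves a
power of `Aᵀ`, so positivity is decided by `A` and integrability by the logarithms. -/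
lemma matProd_bounds {A : Matrix ι ι ℝ} (hA : ∀ l k, 0 ≤ A l k) {r : ℕ → ι → ℝ}
    (hr : ∀ j k, 0 < r j k) (n : ℕ) (l k : ι) :
    Real.exp (-logSize r n) * (A.transpose ^ n) l k ≤ matProd A r n l k ∧
      matProd A r n l k ≤ Real.exp (logSize r n) * (A.transpose ^ n) l k := by
  induction n generalizing l k with
  | zero => simp [matProd, logSize]
  | succ n ih =>
    have hpow : 0 ≤ ∑ p, (A.transpose ^ n) l p * A k p := by
      refine Finset.sum_nonneg fun p _ => mul_nonneg ?_ (hA k p)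
      exact Matrix.pow_apply_nonneg (fun i j => hA j i) n l p
    have hlog : |Real.log (r n k)| ≤ ∑ k, |Real.log (r n k)| :=
      Finset.single_le_sum (f := fun k => |Real.log (r n k)|) (fun _ _ => abs_nonneg _)
        (Finset.mem_univ k)
    have hlow : Real.exp (-∑ k, |Real.log (r n k)|) ≤ r n k := by
      rw [← Real.le_log_iff_exp_le (hr n k)]
      linarith [neg_abs_le (Real.log (r n k))]
    have hup : r n k ≤ Real.exp (∑ k, |Real.log (r n k)|) := by
      rw [← Real.log_le_iff_le_exp (hr n k)]
      linarith [le_abs_self (Real.log (r n k))]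
    have hT : logSize r (n + 1) = logSize r n + ∑ k, |Real.log (r n k)| :=
      Finset.sum_range_succ _ _
    have hP : (A.transpose ^ (n + 1)) l k = ∑ p, (A.transpose ^ n) l p * A k p := by
      rw [pow_succ, Matrix.mul_apply]; rfl
    have h1 : Real.exp (-logSize r n) * ∑ p, (A.transpose ^ n) l p * A k p ≤
        ∑ p, matProd A r n l p * A k p := by
      rw [Finset.mul_sum]
      refine Finset.sum_le_sum fun p _ => ?_
      rw [← mul_assoc]
      exact mul_le_mul_of_nonneg_right (ih l p).1 (hA k p)
    have h2 : ∑ p, matProd A r n l p * A k p ≤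
        Real.exp (logSize r n) * ∑ p, (A.transpose ^ n) l p * A k p := by
      rw [Finset.mul_sum]
      refine Finset.sum_le_sum fun p _ => ?_
      rw [← mul_assoc]
      exact mul_le_mul_of_nonneg_right (ih l p).2 (hA k p)
    rw [matProd_succ_apply, hT, hP, neg_add, Real.exp_add, Real.exp_add]
    have h0 := mul_nonneg (Real.exp_pos (-logSize r n)).le hpow
    constructor
    · calc _ = (Real.exp (-logSize r n) * ∑ p, (A.transpose ^ n) l p * A k p) *
            Real.exp (-∑ k, |Real.log (r n k)|) := by ring
        _ ≤ _ := mul_le_mul h1 hlow (Real.exp_pos _).le (h0.trans h1)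
    · calc _ ≤ (Real.exp (logSize r n) * ∑ p, (A.transpose ^ n) l p * A k p) *
            Real.exp (∑ k, |Real.log (r n k)|) :=
          mul_le_mul h2 hup (hr n k).le ((h0.trans h1).trans h2)
        _ = _ := by ring

lemma matProd_nonneg {A : Matrix ι ι ℝ} (hA : ∀ l k, 0 ≤ A l k) {r : ℕ → ι → ℝ}
    (hr : ∀ j k, 0 < r j k) (n : ℕ) (l k : ι) : 0 ≤ matProd A r n l k :=
  (mul_nonneg (Real.exp_pos _).le (Matrix.pow_apply_nonneg (fun i j => hA j i) n l k)).trans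
    (matProd_bounds hA hr n l k).1

lemma sum_transpose_pow_row {A : Matrix ι ι ℝ} (hA_sum : ∀ k, ∑ l, A l k = 1) (n : ℕ) (l : ι) :
    ∑ k, (A.transpose ^ n) l k = 1 := by
  induction n with
  | zero => simp [Matrix.one_apply]
  | succ n ih =>
    simp only [pow_succ, Matrix.mul_apply, Matrix.transpose_apply]
    rw [Finset.sum_comm]
    simp [← Finset.mul_sum, hA_sum, ih]

/-- Once a power of a left-stochastic matrix is positive, so are all later powers. -/
lemma transpose_pow_pos {A : Matrix ι ι ℝ} (hA : ∀ l k, 0 ≤ A l k)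
    (hA_sum : ∀ k, ∑ l, A l k = 1) {N : ℕ} (hN : ∀ l k, 0 < (A.transpose ^ N) l k) {n : ℕ}
    (hn : N ≤ n) (l k : ι) : 0 < (A.transpose ^ n) l k := by
  induction n, hn using Nat.le_induction generalizing l k with
  | base => exact hN l k
  | succ n _ ih =>
    rw [pow_succ', Matrix.mul_apply]
    obtain ⟨p, hp⟩ : ∃ p, 0 < A p l := by
      by_contra! h
      have := Finset.sum_nonpos fun p (_ : p ∈ Finset.univ) => h p
      rw [hA_sum] at this
      linarith
    exact Finset.sum_pos' (fun q _ => mul_nonneg (hA q l) (ih q k).le)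
      ⟨p, Finset.mem_univ p, mul_pos hp (ih p k)⟩

/-- The powers of `Aᵀ` have row sums 1, so their entry sum is the number of agents for every `n`. -/
lemma entrySum_matProd_bounds {A : Matrix ι ι ℝ} (hA : ∀ l k, 0 ≤ A l k)
    (hA_sum : ∀ k, ∑ l, A l k = 1) {r : ℕ → ι → ℝ} (hr : ∀ j k, 0 < r j k) (n : ℕ) :
    Real.exp (-logSize r n) * Fintype.card ι ≤ entrySum (matProd A r n) ∧
      entrySum (matProd A r n) ≤ Real.exp (logSize r n) * Fintype.card ι := by
  have hcard : (Fintype.card ι : ℝ) = ∑ l, ∑ k, (A.transpose ^ n) l k := by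
    simp [sum_transpose_pow_row hA_sum]
  rw [hcard, entrySum]
  simp only [Finset.mul_sum]
  exact ⟨Finset.sum_le_sum fun l _ => Finset.sum_le_sum fun k _ => (matProd_bounds hA hr n l k).1,
    Finset.sum_le_sum fun l _ => Finset.sum_le_sum fun k _ => (matProd_bounds hA hr n l k).2⟩

variable [Nonempty ι]

lemma entrySum_matProd_pos {A : Matrix ι ι ℝ} (hA : ∀ l k, 0 ≤ A l k)
    (hA_sum : ∀ k, ∑ l, A l k = 1) {r : ℕ → ι → ℝ} (hr : ∀ j k, 0 < r j k) (n : ℕ) :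
    0 < entrySum (matProd A r n) :=
  (by positivity : (0 : ℝ) < _).trans_le (entrySum_matProd_bounds hA hA_sum hr n).1

lemma abs_log_entrySum_matProd_le {A : Matrix ι ι ℝ} (hA : ∀ l k, 0 ≤ A l k)
    (hA_sum : ∀ k, ∑ l, A l k = 1) {r : ℕ → ι → ℝ} (hr : ∀ j k, 0 < r j k) (n : ℕ) :
    |Real.log (entrySum (matProd A r n))| ≤ logSize r n + Real.log (Fintype.card ι) := by
  obtain ⟨h1, h2⟩ := entrySum_matProd_bounds hA hA_sum hr n
  have hpos := entrySum_matProd_pos hA hA_sum hr n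
  have hK : (0 : ℝ) < Fintype.card ι := by positivity
  have h1' := Real.log_le_log (by positivity) h1
  have h2' := Real.log_le_log hpos h2
  rw [Real.log_mul (Real.exp_pos _).ne' hK.ne', Real.log_exp] at h1' h2'
  have : 0 ≤ Real.log (Fintype.card ι) := Real.log_natCast_nonneg _
  rw [abs_le]
  constructor <;> linarith

lemma entryMin_matProd_pos {A : Matrix ι ι ℝ} (hA : ∀ l k, 0 ≤ A l k) {r : ℕ → ι → ℝ}
    (hr : ∀ j k, 0 < r j k) {n : ℕ} (hn : ∀ l k, 0 < (A.transpose ^ n) l k) :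
    0 < entryMin (matProd A r n) :=
  entryMin_pos fun l k =>
    (mul_pos (Real.exp_pos _) (hn l k)).trans_le (matProd_bounds hA hr n l k).1

lemma log_entryMin_matProd_ge {A : Matrix ι ι ℝ} (hA : ∀ l k, 0 ≤ A l k) {r : ℕ → ι → ℝ}
    (hr : ∀ j k, 0 < r j k) {n : ℕ} (hn : ∀ l k, 0 < (A.transpose ^ n) l k) :
    -logSize r n + Real.log (entryMin (A.transpose ^ n)) ≤
      Real.log (entryMin (matProd A r n)) := by
  have hpos := entryMin_pos hn
  rw [← Real.log_exp (-logSize r n), ← Real.log_mul (Real.exp_pos _).ne' hpos.ne']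
  refine Real.log_le_log (by positivity) (le_entryMin fun l k => ?_)
  exact (mul_le_mul_of_nonneg_left (entryMin_le _ l k) (Real.exp_pos _).le).trans
    (matProd_bounds hA hr n l k).1

/-- Removing an initial segment changes the smallest entry by a bounded factor. -/
lemma le_entryMin_matProd_add {A : Matrix ι ι ℝ} (hA : ∀ l k, 0 ≤ A l k)
    (hA_sum : ∀ k, ∑ l, A l k = 1) {r : ℕ → ι → ℝ} (hr : ∀ j k, 0 < r j k) (s n : ℕ)
    (hn : 0 ≤ entryMin (matProd A (fun j => r (s + j)) n)) :
    Real.exp (-logSize r s) * entryMin (matProd A (fun j => r (s + j)) n) ≤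
      entryMin (matProd A r (s + n)) := by
  refine le_entryMin fun l k => ?_
  -- The initial segment may have zero entries, so supermultiplicativity of the smallest entry is of
  -- no use; the unit row sums of `Aᵀ ^ s` replace it.
  rw [matProd_add, Matrix.mul_apply]
  calc _ = ∑ p, Real.exp (-logSize r s) * (A.transpose ^ s) l p *
        entryMin (matProd A (fun j => r (s + j)) n) := by
        rw [← Finset.sum_mul, ← Finset.mul_sum, sum_transpose_pow_row hA_sum, mul_one]
    _ ≤ _ := Finset.sum_le_sum fun p _ => mul_le_mul (matProd_bounds hA hr s l p).1
        (entryMin_le _ p k) hn (matProd_nonneg hA hr s l p)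

lemma log_entrySum_le_sum {A : Matrix ι ι ℝ} (hA : ∀ l k, 0 ≤ A l k)
    (hA_sum : ∀ k, ∑ l, A l k = 1) {r : ℕ → ι → ℝ} (hr : ∀ j k, 0 < r j k) (M n : ℕ) :
    Real.log (entrySum (matProd A r (M * n))) ≤ Real.log (Fintype.card ι) +
      ∑ q ∈ Finset.range n, Real.log (entrySum (matProd A (fun j => r (M * q + j)) M)) := by
  induction n with
  -- The empty product is the identity, whose entry sum is the number of agents; this is the source
  -- of the additive constant.
  | zero => simp [matProd, entrySum, Matrix.one_apply]
  | succ n ih =>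
    have hr' : ∀ j k, 0 < (fun j => r (M * n + j)) j k := fun j k => hr _ k
    rw [Nat.mul_succ, matProd_add, Finset.sum_range_succ, ← add_assoc]
    have h1 := entrySum_matProd_pos hA hA_sum hr (M * n)
    have h2 := entrySum_matProd_pos hA hA_sum hr' M
    refine (Real.log_le_log ?_ (entrySum_mul_le (matProd_nonneg hA hr _)
      (matProd_nonneg hA hr' _))).trans ?_
    · rw [← matProd_add]; exact entrySum_matProd_pos hA hA_sum hr _
    · rw [Real.log_mul h1.ne' h2.ne']
      linarith

/-- The count starts at one block because the identity matrix has smallest entry 0 as soon as there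
are two agents. -/
lemma sum_log_entryMin_le {A : Matrix ι ι ℝ} (hA : ∀ l k, 0 ≤ A l k)
    {r : ℕ → ι → ℝ} (hr : ∀ j k, 0 < r j k) {M : ℕ} (hM : ∀ l k, 0 < (A.transpose ^ M) l k)
    (n : ℕ) :
    0 < entryMin (matProd A r (M * (n + 1))) ∧
    ∑ q ∈ Finset.range (n + 1), Real.log (entryMin (matProd A (fun j => r (M * q + j)) M)) ≤
      Real.log (entryMin (matProd A r (M * (n + 1)))) := by
  induction n with
  | zero => simpa using entryMin_matProd_pos hA hr hM
  | succ n ih =>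
    have hr' : ∀ j k, 0 < (fun j => r (M * (n + 1) + j)) j k := fun j k => hr _ k
    have h2 := entryMin_matProd_pos hA hr' hM
    have h3 := entryMin_mul_le ih.1.le h2.le
    rw [Nat.mul_succ _ (n + 1), matProd_add, Finset.sum_range_succ]
    refine ⟨(mul_pos ih.1 h2).trans_le h3, ?_⟩
    refine le_trans ?_ (Real.log_le_log (mul_pos ih.1 h2) h3)
    rw [Real.log_mul ih.1.ne' h2.ne']
    linarith [ih.2]

end MatrixProducts

/-! ### Stationarity, independence and the strong law for blocks -/

section BlockLaw

variable {Ω E : Type*} [MeasurableSpace Ω] [MeasurableSpace E] {P : Measure Ω}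
  {R : ℕ → Ω → E}

/-- An i.i.d. sequence is stationary. -/
lemma identDistrib_shift (hR : ∀ j, Measurable (R j)) (hind : iIndepFun R P)
    (hid : ∀ j, IdentDistrib (R j) (R 0) P P) (a : ℕ) :
    IdentDistrib (fun ω j => R (a + j) ω) (fun ω j => R j ω) P P where
  aemeasurable_fst := (measurable_pi_iff.2 fun j => hR (a + j)).aemeasurable
  aemeasurable_snd := (measurable_pi_iff.2 hR).aemeasurable
  map_eq := by
    -- Independence makes both path laws infinite products of their marginals, and the marginals
    -- agree.
    have h := hind.precomp (g := fun j => a + j) (fun i j h => by simpa using h)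
    have h1 := h.map_fun_eq_infinitePi_map₀' (fun j => (hR (a + j)).aemeasurable)
    have h2 := hind.map_fun_eq_infinitePi_map₀' (fun j => (hR j).aemeasurable)
    refine h1.trans (Eq.trans ?_ h2.symm)
    congr 1
    funext j
    exact ((hid (a + j)).trans (hid j).symm).map_eq

lemma indepFun_blocks [Nonempty E] (hR : ∀ j, Measurable (R j)) (hind : iIndepFun R P)
    {F : (ℕ → E) → ℝ} (hF : Measurable F) {M : ℕ} (hdep : DependsOn F (Set.Iio M)) {a b : ℕ}
    (hab : a + M ≤ b) :
    IndepFun (fun ω => F fun j => R (a + j) ω) (fun ω => F fun j => R (b + j) ω) P := by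
  classical
  let S : Finset ℕ := Finset.Ico a (a + M)
  let T : Finset ℕ := Finset.Ico b (b + M)
  have hST : Disjoint S T := by
    rw [Finset.disjoint_left]
    intro x hx hy
    simp only [S, T, Finset.mem_Ico] at hx hy
    omega
  -- `g` evaluates `F` on a finite block, filling the other coordinates with an arbitrary value; by
  -- `hdep`, `F` does not read these.
  let g (c : ℕ) (U : Finset ℕ) (v : U → E) : ℝ :=
    F fun j => if h : c + j ∈ U then v ⟨c + j, h⟩ else Classical.arbitrary E
  have hg (c : ℕ) (U : Finset ℕ) : Measurable (g c U) := by
    refine hF.comp (measurable_pi_iff.2 fun j => ?_)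
    by_cases h : c + j ∈ U
    · simpa [h] using measurable_pi_apply _
    · simp [h]
  have hFg (c : ℕ) : (fun ω => F fun j => R (c + j) ω) =
      g c (Finset.Ico c (c + M)) ∘ fun ω (i : Finset.Ico c (c + M)) => R i ω := by
    funext ω
    refine hdep fun j hj => ?_
    have : c + j ∈ Finset.Ico c (c + M) := by
      have : j < M := hj
      simp [this]
    rw [dif_pos this]
  rw [hFg a, hFg b]
  exact (hind.indepFun_finset S T hST hR).comp (hg a S) (hg b T)

/-- The strong law of large numbers along consecutive blocks of length `M` of an i.i.d. sequence. -/
lemma strong_law_blocks [Nonempty E] (hR : ∀ j, Measurable (R j)) (hind : iIndepFun R P)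
    (hid : ∀ j, IdentDistrib (R j) (R 0) P P) {F : (ℕ → E) → ℝ} (hF : Measurable F) {M : ℕ}
    (hdep : DependsOn F (Set.Iio M)) (hint : Integrable (fun ω => F fun j => R j ω) P) (s : ℕ) :
    ∀ᵐ ω ∂P, Tendsto (fun n : ℕ => (∑ q ∈ Finset.range n, F fun j => R (s + (M * q + j)) ω) / n)
      atTop (𝓝 (∫ ω, F (fun j => R j ω) ∂P)) := by
  have hident (a : ℕ) : IdentDistrib (fun ω => F fun j => R (a + j) ω)
      (fun ω => F fun j => R j ω) P P := (identDistrib_shift hR hind hid a).comp hF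
  have h := strong_law_ae_real (μ := P) (fun q ω => F fun j => R (s + M * q + j) ω)
    ((hident _).integrable_iff.2 hint) ?_
    (fun q => (hident _).trans (hident _).symm)
  · rw [(hident _).integral_eq] at h
    simpa only [add_assoc] using h
  -- Pairwise independence suffices for the strong law.
  · intro p q hpq
    have key {p q : ℕ} (h : p < q) : s + M * p + M ≤ s + M * q := by
      have := Nat.mul_le_mul_left M (Nat.succ_le_of_lt h)
      rw [Nat.mul_succ] at this
      omega
    rcases lt_or_gt_of_ne hpq with h | h
    · exact indepFun_blocks hR hind hF hdep (key h)
    · exact (indepFun_blocks hR hind hF hdep (key h)).symm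

end BlockLaw

/-! ### Integrability of the log-likelihood ratio -/

namespace LikelihoodModel

variable {ι Θ : Type*} {𝒳 : ι → Type*} [∀ k, MeasurableSpace (𝒳 k)]

lemma ae_pos_law (M : LikelihoodModel ι Θ 𝒳) (k : ι) (θ : Θ) :
    ∀ᵐ x ∂M.law k θ, 0 < M.L k θ x := by
  rw [law, ae_withDensity_iff (M.measurable_L k θ).ennreal_ofReal]
  exact Eventually.of_forall fun x hx => by simpa using hx

instance (M : LikelihoodModel ι Θ 𝒳) (k : ι) (θ : Θ) : IsProbabilityMeasure (M.law k θ) :=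
  ⟨by rw [law, withDensity_apply _ MeasurableSet.univ, setLIntegral_univ, M.lintegral_L]⟩

/-- Absolute continuity makes `L k θ` positive almost everywhere that `L k θ₀` is, so the quotient
cancels. The density is taken relative to the probability measure `M.law k θ` because `ref k` need
not be σ-finite. -/
lemma law_eq_withDensity (M : LikelihoodModel ι Θ 𝒳) (k : ι) {θ₀ θ : Θ}
    (hac : M.law k θ₀ ≪ M.law k θ) :
    M.law k θ₀ = (M.law k θ).withDensity
      (fun x => ENNReal.ofReal (M.L k θ₀ x) / ENNReal.ofReal (M.L k θ x)) := by
  have h0 := (M.measurable_L k θ₀).ennreal_ofReal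
  have h1 := (M.measurable_L k θ).ennreal_ofReal
  have hpos : ∀ᵐ x ∂M.law k θ₀, 0 < M.L k θ x := hac.ae_le (M.ae_pos_law k θ)
  rw [law, ae_withDensity_iff h0] at hpos
  conv_rhs => rw [law]
  rw [← withDensity_mul _ h1 (by fun_prop), law]
  refine withDensity_congr_ae ?_
  filter_upwards [hpos] with x hx
  rw [Pi.mul_apply]
  by_cases hz : ENNReal.ofReal (M.L k θ₀ x) = 0
  · simp [hz]
  · rw [ENNReal.mul_div_cancel (by simpa using hx hz) ENNReal.ofReal_ne_top]

/-- Finite KL divergence means absolute continuity and an integrable log-likelihood ratio `llr`,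
which is almost surely the negative of the logarithm here. -/
lemma integrable_log_ratio_law (M : LikelihoodModel ι Θ 𝒳) (k : ι) {θ₀ θ : Θ}
    (h : klDiv (M.law k θ₀) (M.law k θ) < ∞) :
    (∀ᵐ x ∂M.law k θ₀, 0 < M.L k θ x / M.L k θ₀ x) ∧
      Integrable (fun x => Real.log (M.L k θ x / M.L k θ₀ x)) (M.law k θ₀) := by
  obtain ⟨hac, hint⟩ := klDiv_ne_top_iff.1 h.ne
  have h0 := (M.measurable_L k θ₀).ennreal_ofReal
  have h1 := (M.measurable_L k θ).ennreal_ofReal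
  have hpos : ∀ᵐ x ∂M.law k θ₀, 0 < M.L k θ x := hac.ae_le (M.ae_pos_law k θ)
  have hd := Measure.rnDeriv_withDensity (M.law k θ) (h0.div h1)
  change ((M.law k θ).withDensity (fun x => ENNReal.ofReal (M.L k θ₀ x) /
    ENNReal.ofReal (M.L k θ x))).rnDeriv _ =ᵐ[_] _ at hd
  rw [← M.law_eq_withDensity k hac] at hd
  refine ⟨?_, hint.neg.congr ?_⟩
  · filter_upwards [hpos, M.ae_pos_law k θ₀] with x hx hx0 using div_pos hx hx0
  · filter_upwards [hac.ae_le hd, hpos, M.ae_pos_law k θ₀] with x hx h1 h0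
    rw [Pi.neg_apply, llr, hx, Pi.div_apply, ENNReal.toReal_div, ENNReal.toReal_ofReal h0.le,
      ENNReal.toReal_ofReal h1.le, ← Real.log_inv, inv_div]

end LikelihoodModel

/-! ### Growth rate of products of i.i.d. random matrices -/

section RandomProducts

lemma tendsto_div_arithmetic {X : ℕ → ℝ} {x : ℝ} (hX : Tendsto (fun n : ℕ => X n / n) atTop (𝓝 x))
    (C : ℝ) {M : ℕ} (hM : M ≠ 0) (s : ℕ) :
    Tendsto (fun n : ℕ => (C + X n) / ((M * n + s : ℕ) : ℝ)) atTop (𝓝 (x / M)) := by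
  have hM' : (M : ℝ) ≠ 0 := Nat.cast_ne_zero.2 hM
  have h0 (c : ℝ) : Tendsto (fun n : ℕ => c / (n : ℝ)) atTop (𝓝 0) :=
    tendsto_const_div_atTop_nhds_zero_nat c
  have h := ((h0 C).add hX).div ((tendsto_const_nhds (x := (M : ℝ))).add (h0 s))
    (by simpa using hM')
  rw [zero_add, add_zero] at h
  refine h.congr' ?_
  filter_upwards [eventually_gt_atTop 0] with n hn
  have hn' : (n : ℝ) ≠ 0 := Nat.cast_ne_zero.2 hn.ne'
  have h2 : ((M * n + s : ℕ) : ℝ) = ((M : ℝ) + s / n) * n := by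
    push_cast
    field_simp
  rw [Pi.div_apply, h2, ← add_div, div_div, mul_comm (n : ℝ)]

variable {Ω : Type*} [MeasurableSpace Ω] {P : Measure Ω}

/-- The exceptional set may depend on `ε`; the countably many values `1 / (n + 1)` suffice. -/
lemma ae_tendsto_of_forall_pos {x : ℕ → Ω → ℝ} {γ : ℝ}
    (h : ∀ ε > 0, ∀ᵐ ω ∂P, ∀ᶠ i in atTop, |x i ω - γ| < ε) :
    ∀ᵐ ω ∂P, Tendsto (fun i => x i ω) atTop (𝓝 γ) := by
  have h' := ae_all_iff.2 fun n : ℕ => h (1 / ((n : ℝ) + 1)) (by positivity)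
  filter_upwards [h'] with ω hω
  rw [Metric.tendsto_nhds]
  intro ε hε
  obtain ⟨n, hn⟩ := exists_nat_one_div_lt hε
  filter_upwards [hω n] with i hi
  rw [Real.dist_eq]
  exact hi.trans hn

variable {ι : Type*} [Fintype ι] [DecidableEq ι]

lemma measurable_log_entrySum (A : Matrix ι ι ℝ) (n : ℕ) :
    Measurable fun r : ℕ → ι → ℝ => Real.log (entrySum (matProd A r n)) :=
  Real.measurable_log.comp (Finset.measurable_sum _ fun l _ => Finset.measurable_sum _ fun k _ =>
    measurable_matProd A n l k)

lemma dependsOn_matProd (A : Matrix ι ι ℝ) (n : ℕ) (f : Matrix ι ι ℝ → ℝ) :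
    DependsOn (fun r : ℕ → ι → ℝ => f (matProd A r n)) (Set.Iio n) :=
  fun _ _ h => congrArg f (matProd_congr A fun j hj => h j hj)

/-- An i.i.d. sequence of vectors with almost surely positive entries whose logarithms are
integrable. -/
structure IsIIDLogIntegrable (R : ℕ → Ω → ι → ℝ) (P : Measure Ω) : Prop where
  measurable : ∀ j, Measurable (R j)
  indep : iIndepFun R P
  identDistrib : ∀ j, IdentDistrib (R j) (R 0) P P
  pos : ∀ k, ∀ᵐ ω ∂P, 0 < R 0 ω k
  integrable_log : ∀ k, Integrable (fun ω => Real.log (R 0 ω k)) P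

namespace IsIIDLogIntegrable

variable {R : ℕ → Ω → ι → ℝ}

omit [DecidableEq ι] in
lemma ae_pos (h : IsIIDLogIntegrable R P) : ∀ᵐ ω ∂P, ∀ j k, 0 < R j ω k := by
  refine ae_all_iff.2 fun j => ae_all_iff.2 fun k => ?_
  exact (h.identDistrib j).symm.ae_snd (p := fun v => 0 < v k)
    (measurableSet_lt measurable_const (measurable_pi_apply k)) (h.pos k)

omit [Fintype ι] [DecidableEq ι] in
lemma measurable_path (h : IsIIDLogIntegrable R P) : Measurable fun ω j => R j ω :=
  measurable_pi_iff.2 h.measurable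

omit [Fintype ι] [DecidableEq ι] in
lemma identDistrib_comp (h : IsIIDLogIntegrable R P) {F : (ℕ → ι → ℝ) → ℝ} (hF : Measurable F)
    (a : ℕ) : IdentDistrib (fun ω => F fun j => R (a + j) ω) (fun ω => F fun j => R j ω) P P :=
  (identDistrib_shift h.measurable h.indep h.identDistrib a).comp hF

omit [DecidableEq ι] in
lemma identDistrib_sum_abs_log (h : IsIIDLogIntegrable R P) (j : ℕ) :
    IdentDistrib (fun ω => ∑ k, |Real.log (R j ω k)|) (fun ω => ∑ k, |Real.log (R 0 ω k)|) P P :=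
  have hu : Measurable fun v : ι → ℝ => ∑ k, |Real.log (v k)| :=
    Finset.measurable_sum _ fun k _ =>
      measurable_norm.comp (Real.measurable_log.comp (measurable_pi_apply k))
  (h.identDistrib j).comp hu

omit [DecidableEq ι] in
lemma integrable_sum_abs_log (h : IsIIDLogIntegrable R P) (j : ℕ) :
    Integrable (fun ω => ∑ k, |Real.log (R j ω k)|) P :=
  (h.identDistrib_sum_abs_log j).integrable_iff.2
    (integrable_finsetSum _ fun k _ => (h.integrable_log k).abs)

omit [DecidableEq ι] in
lemma integrable_logSize (h : IsIIDLogIntegrable R P) (n : ℕ) :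
    Integrable (fun ω => logSize (fun j => R j ω) n) P :=
  integrable_finsetSum _ fun j _ => h.integrable_sum_abs_log j

omit [DecidableEq ι] in
lemma integral_logSize (h : IsIIDLogIntegrable R P) (n : ℕ) :
    ∫ ω, logSize (fun j => R j ω) n ∂P = n * ∫ ω, ∑ k, |Real.log (R 0 ω k)| ∂P := by
  simp only [logSize]
  rw [integral_finsetSum _ fun j _ => h.integrable_sum_abs_log j]
  simp [fun j => (h.identDistrib_sum_abs_log j).integral_eq]

variable [Nonempty ι] [IsProbabilityMeasure P] {A : Matrix ι ι ℝ}

lemma integrable_log_entrySum (h : IsIIDLogIntegrable R P) (hA : ∀ l k, 0 ≤ A l k)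
    (hA_sum : ∀ k, ∑ l, A l k = 1) (n : ℕ) :
    Integrable (fun ω => Real.log (entrySum (matProd A (fun j => R j ω) n))) P := by
  refine ((h.integrable_logSize n).add (integrable_const (Real.log (Fintype.card ι)))).mono'
    ((measurable_log_entrySum A n).comp h.measurable_path).aestronglyMeasurable ?_
  filter_upwards [h.ae_pos] with ω hω using abs_log_entrySum_matProd_le hA hA_sum hω n

lemma measurable_log_entryMin (A : Matrix ι ι ℝ) (n : ℕ) :
    Measurable fun r : ℕ → ι → ℝ => Real.log (entryMin (matProd A r n)) := by
  refine Real.measurable_log.comp ?_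
  unfold entryMin
  have key : Measurable (Finset.univ.inf' Finset.univ_nonempty
      fun (p : ι × ι) (r : ℕ → ι → ℝ) => matProd A r n p.1 p.2) :=
    Finset.inf'_induction (p := Measurable) _ _ (fun _ hf _ hg => hf.inf hg)
      fun p _ => measurable_matProd A n p.1 p.2
  convert! key using 2 with r
  rw [Finset.inf'_apply]

lemma integrable_log_entryMin (h : IsIIDLogIntegrable R P) (hA : ∀ l k, 0 ≤ A l k)
    (hA_sum : ∀ k, ∑ l, A l k = 1) {n : ℕ} (hn : ∀ l k, 0 < (A.transpose ^ n) l k) :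
    Integrable (fun ω => Real.log (entryMin (matProd A (fun j => R j ω) n))) P := by
  refine integrable_of_le_of_le
    ((measurable_log_entryMin A n).comp h.measurable_path).aestronglyMeasurable ?_ ?_
    ((h.integrable_logSize n).neg.add
      (integrable_const (Real.log (entryMin (A.transpose ^ n)))))
    (h.integrable_log_entrySum hA hA_sum n)
  · filter_upwards [h.ae_pos] with ω hω using log_entryMin_matProd_ge hA hω hn
  · filter_upwards [h.ae_pos] with ω hω
    exact Real.log_le_log (entryMin_matProd_pos hA hω hn)
      (entryMin_le_entrySum (matProd_nonneg hA hω n))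

lemma integrable_log_entry (h : IsIIDLogIntegrable R P) (hA : ∀ l k, 0 ≤ A l k)
    (hA_sum : ∀ k, ∑ l, A l k = 1) {n : ℕ} (hn : ∀ l k, 0 < (A.transpose ^ n) l k) (l k : ι) :
    Integrable (fun ω => Real.log (matProd A (fun j => R j ω) n l k)) P := by
  refine integrable_of_le_of_le
    ((Real.measurable_log.comp
      (measurable_matProd A n l k)).comp h.measurable_path).aestronglyMeasurable ?_ ?_
    (h.integrable_log_entryMin hA hA_sum hn) (h.integrable_log_entrySum hA hA_sum n)
  · filter_upwards [h.ae_pos] with ω hω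
      using (log_entry_bounds (entryMin_matProd_pos hA hω hn) l k).1
  · filter_upwards [h.ae_pos] with ω hω
      using (log_entry_bounds (entryMin_matProd_pos hA hω hn) l k).2

/-- The expectation of the logarithm of the sum of the entries is subadditive. -/
lemma subadditive_integral_log_entrySum (h : IsIIDLogIntegrable R P) (hA : ∀ l k, 0 ≤ A l k)
    (hA_sum : ∀ k, ∑ l, A l k = 1) :
    Subadditive fun n => ∫ ω, Real.log (entrySum (matProd A (fun j => R j ω) n)) ∂P := by
  intro m n
  have hid := h.identDistrib_comp (measurable_log_entrySum A n) m
  have hi := h.integrable_log_entrySum hA hA_sum m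
  have hj := hid.integrable_iff.2 (h.integrable_log_entrySum hA hA_sum n)
  simp only
  rw [← hid.integral_eq, ← integral_add hi hj]
  refine integral_mono_ae (h.integrable_log_entrySum hA hA_sum _) (hi.add hj) ?_
  filter_upwards [h.ae_pos] with ω hω
  have hω' : ∀ j k, 0 < (fun j => R (m + j) ω) j k := fun j k => hω _ k
  have h1 := entrySum_matProd_pos hA hA_sum hω m
  have h2 := entrySum_matProd_pos hA hA_sum hω' n
  rw [← Real.log_mul h1.ne' h2.ne']
  refine Real.log_le_log (entrySum_matProd_pos hA hA_sum hω _) ?_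
  rw [matProd_add]
  exact entrySum_mul_le (matProd_nonneg hA hω m) (matProd_nonneg hA hω' n)

/-- This keeps the Fekete limit from being `-∞`: the mean of `logSize` is linear in `n`. -/
lemma bddBelow_integral_log_entrySum_div (h : IsIIDLogIntegrable R P) (hA : ∀ l k, 0 ≤ A l k)
    (hA_sum : ∀ k, ∑ l, A l k = 1) :
    BddBelow (Set.range fun n : ℕ =>
      (∫ ω, Real.log (entrySum (matProd A (fun j => R j ω) n)) ∂P) / n) := by
  have hK : 0 ≤ Real.log (Fintype.card ι) := Real.log_natCast_nonneg _
  have hD : 0 ≤ ∫ ω, ∑ k, |Real.log (R 0 ω k)| ∂P :=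
    integral_nonneg fun ω => Finset.sum_nonneg fun k _ => abs_nonneg _
  refine ⟨-(∫ ω, ∑ k, |Real.log (R 0 ω k)| ∂P) - Real.log (Fintype.card ι), ?_⟩
  rintro _ ⟨n, rfl⟩
  -- At `n = 0` the quotient is 0 by convention, and the chosen bound is nonpositive.
  rcases Nat.eq_zero_or_pos n with rfl | hn
  · simp only [Nat.cast_zero, div_zero]
    linarith
  have hn1 : (1 : ℝ) ≤ n := by exact_mod_cast hn
  have hle : ∫ ω, (-logSize (fun j => R j ω) n - Real.log (Fintype.card ι)) ∂P ≤
      ∫ ω, Real.log (entrySum (matProd A (fun j => R j ω) n)) ∂P := by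
    refine integral_mono_ae ((h.integrable_logSize n).neg.sub (integrable_const _))
      (h.integrable_log_entrySum hA hA_sum n) ?_
    filter_upwards [h.ae_pos] with ω hω
    have := (abs_le.1 (abs_log_entrySum_matProd_le hA hA_sum hω n)).1
    linarith
  rw [integral_sub (f := fun ω => -logSize (fun j => R j ω) n) (h.integrable_logSize n).neg
    (integrable_const _), integral_neg, h.integral_logSize, integral_const, probReal_univ, one_smul] at hle
  rw [le_div_iff₀ (by linarith)]
  nlinarith

/-- Between two blocks with positive entries, the smallest entry controls the sum of the entries of
the middle block. -/
lemma integral_log_entryMin_ge (h : IsIIDLogIntegrable R P) (hA : ∀ l k, 0 ≤ A l k)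
    (hA_sum : ∀ k, ∑ l, A l k = 1) {N : ℕ} (hN : ∀ l k, 0 < (A.transpose ^ N) l k) (m : ℕ) :
    2 * (∫ ω, Real.log (entryMin (matProd A (fun j => R j ω) N)) ∂P) +
      ∫ ω, Real.log (entrySum (matProd A (fun j => R j ω) m)) ∂P ≤
      ∫ ω, Real.log (entryMin (matProd A (fun j => R j ω) (N + m + N))) ∂P := by
  have hidS := h.identDistrib_comp (measurable_log_entrySum A m) N
  have hidM := h.identDistrib_comp (measurable_log_entryMin A N) (N + m)
  have hi := h.integrable_log_entryMin hA hA_sum hN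
  have hj := hidS.integrable_iff.2 (h.integrable_log_entrySum hA hA_sum m)
  have hk := hidM.integrable_iff.2 hi
  have hpos := transpose_pow_pos hA hA_sum hN (n := N + m + N) (by omega)
  -- By stationarity the expectation for a block does not depend on where the block starts.
  have heq : 2 * (∫ ω, Real.log (entryMin (matProd A (fun j => R j ω) N)) ∂P) +
      ∫ ω, Real.log (entrySum (matProd A (fun j => R j ω) m)) ∂P =
      ∫ ω, (Real.log (entryMin (matProd A (fun j => R j ω) N)) +
        Real.log (entrySum (matProd A (fun j => R (N + j) ω) m)) +
        Real.log (entryMin (matProd A (fun j => R (N + m + j) ω) N))) ∂P := by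
    rw [integral_add (f := fun ω => Real.log (entryMin (matProd A (fun j => R j ω) N)) +
      Real.log (entrySum (matProd A (fun j => R (N + j) ω) m))) (hi.add hj) hk, integral_add hi hj, hidS.integral_eq, hidM.integral_eq]
    ring
  rw [heq]
  refine integral_mono_ae ((hi.add hj).add hk) (h.integrable_log_entryMin hA hA_sum hpos) ?_
  filter_upwards [h.ae_pos] with ω hω
  have hω' (a : ℕ) : ∀ j k, 0 < (fun j => R (a + j) ω) j k := fun j k => hω _ k
  have h1 := entryMin_matProd_pos hA hω hN
  have h2 := entrySum_matProd_pos hA hA_sum (hω' N) m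
  have h3 := entryMin_matProd_pos hA (hω' (N + m)) hN
  rw [← Real.log_mul h1.ne' h2.ne', ← Real.log_mul (mul_pos h1 h2).ne' h3.ne']
  refine Real.log_le_log (mul_pos (mul_pos h1 h2) h3) ?_
  rw [matProd_add, matProd_add]
  exact entryMin_mul_mul_le h1.le (matProd_nonneg hA (hω' N) m) h3.le

lemma ae_eventually_log_entrySum_lt (h : IsIIDLogIntegrable R P) (hA : ∀ l k, 0 ≤ A l k)
    (hA_sum : ∀ k, ∑ l, A l k = 1) {M : ℕ} (hM : M ≠ 0) {b : ℝ}
    (hb : (∫ ω, Real.log (entrySum (matProd A (fun j => R j ω) M)) ∂P) / M < b) :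
    ∀ᵐ ω ∂P, ∀ᶠ i : ℕ in atTop,
      Real.log (entrySum (matProd A (fun j => R j ω) i)) / i < b := by
  have hlln := ae_all_iff.2 fun s => strong_law_blocks h.measurable h.indep h.identDistrib
    (measurable_log_entrySum A M) (dependsOn_matProd A M fun X => Real.log (entrySum X))
    (h.integrable_log_entrySum hA hA_sum M) s
  filter_upwards [h.ae_pos, hlln] with ω hω hl
  -- Each residue class `i = M * n + s` is treated separately: the first `s` factors are split off
  -- and `n` full blocks remain.
  refine .atTop_of_arithmetic hM fun s _ => ?_
  have hω' : ∀ j k, 0 < (fun j => R (s + j) ω) j k := fun j k => hω _ k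
  filter_upwards [(tendsto_div_arithmetic (hl s)
    (Real.log (entrySum (matProd A (fun j => R j ω) s)) + Real.log (Fintype.card ι)) hM
    s).eventually_lt_const hb] with n hn
  refine lt_of_le_of_lt ?_ hn
  refine div_le_div_of_nonneg_right ?_ (Nat.cast_nonneg _)
  have h1 := entrySum_matProd_pos hA hA_sum hω s
  have h2 := entrySum_matProd_pos hA hA_sum hω' (M * n)
  have h3 := Real.log_le_log (entrySum_matProd_pos hA hA_sum hω (s + M * n))
    ((congrArg entrySum (matProd_add A _ s (M * n))).trans_le
      (entrySum_mul_le (matProd_nonneg hA hω s) (matProd_nonneg hA hω' (M * n))))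
  rw [Real.log_mul h1.ne' h2.ne'] at h3
  rw [add_comm (M * n)]
  linarith [log_entrySum_le_sum hA hA_sum hω' M n]

lemma ae_eventually_lt_log_entryMin (h : IsIIDLogIntegrable R P) (hA : ∀ l k, 0 ≤ A l k)
    (hA_sum : ∀ k, ∑ l, A l k = 1) {M : ℕ} (hM : M ≠ 0)
    (hpos : ∀ l k, 0 < (A.transpose ^ M) l k) {b : ℝ}
    (hb : b < (∫ ω, Real.log (entryMin (matProd A (fun j => R j ω) M)) ∂P) / M) :
    ∀ᵐ ω ∂P, ∀ᶠ i : ℕ in atTop,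
      b < Real.log (entryMin (matProd A (fun j => R j ω) i)) / i := by
  have hlln := ae_all_iff.2 fun s => strong_law_blocks h.measurable h.indep h.identDistrib
    (measurable_log_entryMin A M) (dependsOn_matProd A M fun X => Real.log (entryMin X))
    (h.integrable_log_entryMin hA hA_sum hpos) s
  filter_upwards [h.ae_pos, hlln] with ω hω hl
  refine .atTop_of_arithmetic hM fun s _ => ?_
  have hω' : ∀ j k, 0 < (fun j => R (s + j) ω) j k := fun j k => hω _ k
  -- The first `s` factors cost at most `logSize`, a constant along the residue class that vanishes
  -- after division by `i`.
  filter_upwards [(tendsto_div_arithmetic (hl s) (-logSize (fun j => R j ω) s) hM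
    s).eventually_const_lt hb, eventually_gt_atTop 0] with n hn hn0
  obtain ⟨n, rfl⟩ := Nat.exists_eq_succ_of_ne_zero hn0.ne'
  refine hn.trans_le ?_
  refine div_le_div_of_nonneg_right ?_ (Nat.cast_nonneg _)
  obtain ⟨h1, h2⟩ := sum_log_entryMin_le hA hω' hpos n
  have h3 := Real.log_le_log (mul_pos (Real.exp_pos _) h1)
    (le_entryMin_matProd_add hA hA_sum hω s (M * (n + 1)) h1.le)
  rw [Real.log_mul (Real.exp_pos _).ne' h1.ne', Real.log_exp] at h3
  rw [add_comm (M * _)]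
  linarith

/-- The entries of the products of i.i.d. random matrices `Aᵀ diag(R j)`, with `A` primitive and
left-stochastic, have one common exponential growth rate. -/
theorem exists_growth_rate (h : IsIIDLogIntegrable R P) (hA : A.IsPrimitive)
    (hA_sum : ∀ k, ∑ l, A l k = 1) :
    ∃ γ : ℝ, ∀ l k : ι,
      (∀ᶠ i : ℕ in atTop, (∀ᵐ ω ∂P, 0 < matProd A (fun j => R j ω) i l k) ∧
        Integrable (fun ω => Real.log (matProd A (fun j => R j ω) i l k)) P) ∧
      (∀ᵐ ω ∂P, Tendsto (fun i : ℕ => Real.log (matProd A (fun j => R j ω) i l k) / i)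
        atTop (𝓝 γ)) ∧
      Tendsto (fun i : ℕ => (∫ ω, Real.log (matProd A (fun j => R j ω) i l k) ∂P) / i)
        atTop (𝓝 γ) := by
  have hA0 := hA.nonneg
  obtain ⟨N, hN0, hN⟩ := hA.exists_pos_pow
  have hN' : ∀ l k, 0 < (A.transpose ^ N) l k := fun l k => by
    rw [← Matrix.transpose_pow]; exact hN k l
  have hpos {n : ℕ} (hn : N ≤ n) := transpose_pow_pos hA0 hA_sum hN' hn
  have hsub := h.subadditive_integral_log_entrySum hA0 hA_sum
  -- Fekete's lemma.
  have hS := hsub.tendsto_lim (h.bddBelow_integral_log_entrySum_div hA0 hA_sum)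
  set γ := hsub.lim
  have hlow : Tendsto (fun n : ℕ =>
      (∫ ω, Real.log (entryMin (matProd A (fun j => R j ω) n)) ∂P) / n) atTop (𝓝 γ) := by
    rw [← tendsto_add_atTop_iff_nat (2 * N)]
    -- With block length 1 and offset `2 * N`, this accounts for the two enclosing blocks in
    -- `integral_log_entryMin_ge`.
    have h1 := tendsto_div_arithmetic hS
      (2 * ∫ ω, Real.log (entryMin (matProd A (fun j => R j ω) N)) ∂P) one_ne_zero (2 * N)
    simp only [one_mul, Nat.cast_one, div_one] at h1
    refine tendsto_of_tendsto_of_tendsto_of_le_of_le h1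
      ((tendsto_add_atTop_iff_nat (2 * N)).2 hS) (fun n => ?_) (fun n => ?_)
    · refine div_le_div_of_nonneg_right ?_ (Nat.cast_nonneg _)
      have := h.integral_log_entryMin_ge hA0 hA_sum hN' n
      rwa [show N + n + N = n + 2 * N by ring] at this
    · refine div_le_div_of_nonneg_right ?_ (Nat.cast_nonneg _)
      have hp := hpos (n := n + 2 * N) (by omega)
      refine integral_mono_ae (h.integrable_log_entryMin hA0 hA_sum hp)
        (h.integrable_log_entrySum hA0 hA_sum _) ?_
      filter_upwards [h.ae_pos] with ω hω
      exact Real.log_le_log (entryMin_matProd_pos hA0 hω hp)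
        (entryMin_le_entrySum (matProd_nonneg hA0 hω _))
  refine ⟨γ, fun l k => ⟨?_, ?_, ?_⟩⟩
  · filter_upwards [eventually_ge_atTop N] with i hi
    refine ⟨?_, h.integrable_log_entry hA0 hA_sum (hpos hi) l k⟩
    filter_upwards [h.ae_pos] with ω hω
    exact (entryMin_matProd_pos hA0 hω (hpos hi)).trans_le (entryMin_le _ l k)
  · refine ae_tendsto_of_forall_pos fun ε hε => ?_
    -- One block length serves both bounds, and `N ≤ M` makes every block positive.
    obtain ⟨M, hM0, hMN, hM1, hM2⟩ := ((eventually_gt_atTop 0).and <|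
      (eventually_ge_atTop N).and <| (hS.eventually_lt_const (lt_add_of_pos_right γ hε)).and
        (hlow.eventually_const_lt (sub_lt_self γ hε))).exists
    filter_upwards [h.ae_pos, h.ae_eventually_log_entrySum_lt hA0 hA_sum hM0.ne' hM1,
      h.ae_eventually_lt_log_entryMin hA0 hA_sum hM0.ne' (hpos hMN) hM2] with ω hω h1 h2
    filter_upwards [h1, h2, eventually_ge_atTop N] with i hi1 hi2 hi
    obtain ⟨h3, h4⟩ := log_entry_bounds (entryMin_matProd_pos hA0 hω (hpos hi)) l k
    have h3' := div_le_div_of_nonneg_right h3 (Nat.cast_nonneg (α := ℝ) i)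
    have h4' := div_le_div_of_nonneg_right h4 (Nat.cast_nonneg (α := ℝ) i)
    rw [abs_lt]
    constructor <;> linarith
  · refine tendsto_of_tendsto_of_tendsto_of_le_of_le' hlow hS ?_ ?_
    · filter_upwards [eventually_ge_atTop N] with i hi
      refine div_le_div_of_nonneg_right ?_ (Nat.cast_nonneg _)
      refine integral_mono_ae (h.integrable_log_entryMin hA0 hA_sum (hpos hi))
        (h.integrable_log_entry hA0 hA_sum (hpos hi) l k) ?_
      filter_upwards [h.ae_pos] with ω hω
        using (log_entry_bounds (entryMin_matProd_pos hA0 hω (hpos hi)) l k).1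
    · filter_upwards [eventually_ge_atTop N] with i hi
      refine div_le_div_of_nonneg_right ?_ (Nat.cast_nonneg _)
      refine integral_mono_ae (h.integrable_log_entry hA0 hA_sum (hpos hi) l k)
        (h.integrable_log_entrySum hA0 hA_sum i) ?_
      filter_upwards [h.ae_pos] with ω hω
        using (log_entry_bounds (entryMin_matProd_pos hA0 hω (hpos hi)) l k).2

end IsIIDLogIntegrable

end RandomProducts

/-! ### Application to the likelihood ratios -/

namespace LikelihoodModel

variable {ι Θ : Type*} {𝒳 : ι → Type*} [∀ k, MeasurableSpace (𝒳 k)]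

lemma measurable_ratio (M : LikelihoodModel ι Θ 𝒳) (θ₀ θ : Θ) : Measurable (M.ratio θ₀ θ) :=
  measurable_pi_iff.2 fun k => ((M.measurable_L k θ).comp (measurable_pi_apply k)).div
    ((M.measurable_L k θ₀).comp (measurable_pi_apply k))

/-- Positivity and log-integrability concern one agent at a time, so only the marginal laws enter
and the dependence between agents plays no role. -/
lemma isIIDLogIntegrable_ratio (M : LikelihoodModel ι Θ 𝒳) {θ₀ : Θ} (hKL : M.FiniteKL θ₀)
    {Ω : Type*} [MeasurableSpace Ω] {P : Measure Ω} {ξ : ℕ → Ω → ∀ k, 𝒳 k}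
    (hξ : M.IsObservation θ₀ P ξ) (θ : Θ) :
    IsIIDLogIntegrable (fun j ω => M.ratio θ₀ θ (ξ j ω)) P where
  measurable j := (M.measurable_ratio θ₀ θ).comp (hξ.measurable j)
  indep := hξ.indep.comp (fun _ => M.ratio θ₀ θ) fun _ => M.measurable_ratio θ₀ θ
  identDistrib j := (hξ.identDistrib j).comp (M.measurable_ratio θ₀ θ)
  pos k := by
    have hm := (measurable_pi_apply k).comp (hξ.measurable 0)
    have h := (M.integrable_log_ratio_law k (hKL k θ)).1
    rw [← hξ.map_eq 0 k] at h
    exact ae_of_ae_map hm.aemeasurable h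
  integrable_log k := by
    have hm := (measurable_pi_apply k).comp (hξ.measurable 0)
    have h := (M.integrable_log_ratio_law k (hKL k θ)).2
    rw [← hξ.map_eq 0 k] at h
    exact h.comp_measurable hm

end LikelihoodModel

theorem corollary1 {ι Θ : Type*} [Fintype ι] [DecidableEq ι] [Nonempty ι] [Finite Θ]
    {𝒳 : ι → Type*} [∀ k, MeasurableSpace (𝒳 k)]
    {Ω : Type*} [MeasurableSpace Ω] (P : Measure Ω) [IsProbabilityMeasure P]
    (M : LikelihoodModel ι Θ 𝒳) (θ₀ : Θ) (hKL : M.FiniteKL θ₀)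
    (ξ : ℕ → Ω → ∀ k, 𝒳 k) (hξ : M.IsObservation θ₀ P ξ)
    (A : Matrix ι ι ℝ) (hA : A.IsPrimitive) (hA_sum : ∀ k, ∑ l, A l k = 1)
    (θ : Θ) :
    ∃ γ : ℝ, ∀ l k : ι,
      (∀ᶠ i : ℕ in atTop,
        (∀ᵐ ω ∂P, 0 < M.matrixProduct A θ₀ θ ξ i ω l k) ∧
        Integrable (fun ω => Real.log (M.matrixProduct A θ₀ θ ξ i ω l k)) P) ∧
      (∀ᵐ ω ∂P, Tendsto
        (fun i : ℕ => (1 / (i : ℝ)) * Real.log (M.matrixProduct A θ₀ θ ξ i ω l k))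
        atTop (𝓝 γ)) ∧
      Tendsto
        (fun i : ℕ => (1 / (i : ℝ)) * ∫ ω, Real.log (M.matrixProduct A θ₀ θ ξ i ω l k) ∂P)
        atTop (𝓝 γ) := by
  obtain ⟨γ, hγ⟩ := (M.isIIDLogIntegrable_ratio hKL hξ θ).exists_growth_rate hA hA_sum
  refine ⟨γ, fun l k => ?_⟩
  simp only [one_div, inv_mul_eq_div]
  -- `matrixProduct` is `matProd` at the ratio sequence by definition.
  exact hγ l k
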